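/- Let $q$ be an indeterminate. For $n\ge 0$ put $[n]_q=1+q+\cdots+q^{n-1}$ (so $[0]_q=0$), $[n]_q!=\prod_{j=1}^n[j]_q$, $\binom{n}{k}_q=\frac{[n]_q!}{[k]_q!\,[n-k]_q!}$ for $0\le k\le n$, and $\binom{n}{k}_q=0$ for $k>n$. Let $t_{n,k}(q)=\binom{n}{k}_q([n]_q)^{n-k}$ for $0\le k\le n$ and $t_{n,k}(q)=0$ for $k>n$ (the entries of the $q$-trees matrix). Let $\mathcal F^*_{n+1,k+1}$ be the set of forests of rooted labelled trees on the vertex set $\{1,\dots,n+1\}$ with $k+1$ components in which the vertex $n+1$ is a leaf, i.e. has no children (a root without children counts as a leaf). For such a forest $F$ let $V_r(F)$ be the set of its roots, and let $v_{\min}$ be the lowest-numbered vertex among all children of roots (it exists exactly when $F$ has a non-root vertex). Let $V_t(F)$ be the set of vertices that are neither roots nor equal to $v_{\min}$; it has $\max(n-k-1,0)$ elements. Define - $\mathrm{niblings}(F)=\sum_{v\in V_r(F)}\#\{v' : v'\notin V_r(F),\ v'<v\}$; - $\mathrm{scindex}(F)=j$, where $v_0<v_1<\cdots<v_k$ are the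 roots of $F$ and $v_j$ is the parent of $v_{\min}$, and $\mathrm{scindex}(F)=0$ if $v_{\min}$ does not exist; - $\mathrm{parents}(F)=\sum_{v\in V_t(F)}p(v)$, where $p(v)$ is the label of the parent of $v$. Then for all integers $n,k\ge 0$ $$t_{n,k}(q)=\sum_{F\in\mathcal F^*_{n+1,k+1}}q^{\,\mathrm{niblings}(F)+\mathrm{scindex}(F)+\mathrm{parents}(F)-\max(n-k-1,\,0)}=\binom{n}{k}_q([n]_q)^{n-k},$$ where for $k>n$ the right-hand side is read as $0$. Equivalently, the exponent is $\mathrm{niblings}(F)+\mathrm{scindex}(F)+\sum_{v\in V_t(F)}(p(v)-1)$. -/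

import Mathlib

/-- A forest of rooted labelled trees on `m` vertices, given by its parent function:
`parent v = none` when `v` is a root, and following parents from any vertex one eventually
runs past a root. The vertex `v : Fin m` carries the label `v + 1`, so that the labels
are `1, …, m` and the order of the labels is the order of `Fin m`. -/
@[ext]
structure RootedForest (m : ℕ) where
  parent : Fin m → Option (Fin m)
  acyclic : ∀ v : Fin m, ∃ j : ℕ, (fun o : Option (Fin m) => o.bind parent)^[j] (some v) = none

namespace RootedForest

noncomputable instance instFintype (m : ℕ) : Fintype (RootedForest m) :=
  Fintype.ofInjective RootedForest.parent fun _ _ h => RootedForest.ext h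

variable {m : ℕ} (F : RootedForest m)

/-- The underlying undirected graph, each non-root being joined to its parent. -/
def graph : SimpleGraph (Fin m) :=
  SimpleGraph.fromRel fun v w => F.parent v = some w

/-- The number of connected components of the forest. -/
noncomputable def numComponents : ℕ :=
  Nat.card F.graph.ConnectedComponent

/-- A leaf is a vertex without children (so a root without children is a leaf, and a root
with a single child is not). -/
def IsLeaf (v : Fin m) : Prop :=
  ∀ w : Fin m, F.parent w ≠ some v

/-- `V_r(F)`: the roots of the components. -/
def roots : Finset (Fin m) :=
  {v | F.parent v = none}

/-- The children of the roots. -/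
def rootChildren : Finset (Fin m) :=
  {v | ∃ r ∈ F.roots, F.parent v = some r}

/-- `V_s(F) = {v_min}`, where `v_min` is the lowest-numbered vertex among the children of all
the roots; it is empty when `F` has no non-root vertex. -/
def smallestRootChild : Finset (Fin m) :=
  {v ∈ F.rootChildren | ∀ w ∈ F.rootChildren, v ≤ w}

/-- `V_t(F)`: the remaining vertices, neither a root nor `v_min`. -/
def remaining : Finset (Fin m) :=
  {v | v ∉ F.roots ∧ v ∉ F.smallestRootChild}

/-- `V_r(F, v)`: the non-root vertices that are lower-numbered than `v`. -/
def lowerNonroots (v : Fin m) : Finset (Fin m) :=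
  {w | w ∉ F.roots ∧ w < v}

/-- The sum, over all roots, of the number of lower-numbered non-root vertices. -/
def niblings : ℕ :=
  ∑ v ∈ F.roots, (F.lowerNonroots v).card

/-- The smallest child index: if the roots are `v_0 < v_1 < ⋯` and `v_j` is the parent of
`v_min`, this is `j`, the number of roots that are smaller than the parent of `v_min`; it is `0`
if there is no `v_min`. (The sum ranges over the at most one element `v_min` of `V_s(F)`.) -/
def scindex : ℕ :=
  ∑ v ∈ F.smallestRootChild, (F.roots.filter fun r => ∃ p, F.parent v = some p ∧ r < p).card

/-- The label (between `1` and `m`) of the parent of `v`; `0` if `v` is a root. -/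
def parentLabel (v : Fin m) : ℕ :=
  match F.parent v with
  | none => 0
  | some p => (p : ℕ) + 1

/-- The sum of the labels of the parents of the vertices in `V_t(F)`. -/
def parents : ℕ :=
  ∑ v ∈ F.remaining, F.parentLabel v

end RootedForest

open Classical in
/-- The forests on `n + 1` vertices with `k + 1` components in which vertex `n + 1` is a leaf. -/
noncomputable def leafForests (n k : ℕ) : Finset (RootedForest (n + 1)) :=
  {F | F.numComponents = k + 1 ∧ F.IsLeaf (Fin.last n)}

/-- The `q`-integer `1 + q + ⋯ + q ^ (n - 1)`, where `q` is the indeterminate of `ℚ(q)`. -/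
noncomputable def qInt (n : ℕ) : RatFunc ℚ :=
  ∑ i ∈ Finset.range n, RatFunc.X ^ i

/-- The `q`-factorial. -/
noncomputable def qFactorial (n : ℕ) : RatFunc ℚ :=
  ∏ j ∈ Finset.Icc 1 n, qInt j

/-- The `q`-binomial coefficient, which is `0` for `k > n`. -/
noncomputable def qBinomial (n k : ℕ) : RatFunc ℚ :=
  if k ≤ n then qFactorial n / (qFactorial k * qFactorial (n - k)) else 0

/-- The `(n, k)` entry of the `q`-trees matrix. -/
noncomputable def qTrees (n k : ℕ) : RatFunc ℚ :=
  qBinomial n k * qInt n ^ (n - k)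

/-!
Cutting the edges between the roots and their children turns a forest with root set `R` into a map
`C → R`, where `C` is the set of these children, and a forest with root set `R ∪ C` in which the
vertices of `R` are isolated. If an edge to a parent `p` has weight `x p` and the edge above `v_min`
is left out, the binomial theorem and induction on the number of non-roots `m` give the total weight
`(∑ v, x v) ^ (m - 1)`; hence the choice of the parent of `v_min` contributes an independent factor.
With `x v = q ^ (v - 1)`, except that `x (n + 1) = 0` makes `n + 1` a leaf, and with the parent of
`v_min` weighted by its rank among the roots, the forests with root set `R` contribute
`[#(R \ {n + 1})]_q * [n]_q ^ (n - k - 1)`. The niblings are the inversions counted by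
`q`-binomial coefficients, and splitting by whether `n + 1` is a root yields the total weight
`([k + 1]_q * binom(n, k + 1)_q + q ^ (n - k) * [k]_q * binom(n, k)_q) * [n]_q ^ (n - k - 1)`,
whose first factor is `[n]_q * binom(n, k)_q`.
-/

open Finset

theorem sum_powersetCard_succ_sum {α M : Type*} [AddCommMonoid M]
    (S : Finset α) (j : ℕ) (f : α → M) :
    ∑ C ∈ powersetCard (j + 1) S, ∑ c ∈ C, f c = (#S - 1).choose j • ∑ c ∈ S, f c := by
  classical
  have hswap : ∑ C ∈ powersetCard (j + 1) S, ∑ c ∈ C, f c =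
      ∑ c ∈ S, ∑ C ∈ powersetCard (j + 1) S with {c} ⊆ C, f c :=
    sum_comm' fun C c => by
      simp only [mem_powersetCard, mem_filter, singleton_subset_iff]
      exact ⟨fun h => ⟨h, h.1.1 h.2⟩, fun h => h.1⟩
  rw [hswap, smul_sum]
  refine sum_congr rfl fun c hc => ?_
  rw [sum_const, card_filter_powersetCard_subset _ _ _ (singleton_subset_iff.2 hc) (by simp),
    card_singleton, Nat.add_sub_cancel]

theorem sum_union_piecewise_zero {α M : Type*} [DecidableEq α] [AddCommMonoid M]
    {R C : Finset α} (hRC : Disjoint R C) (x : α → M) :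
    ∑ v ∈ R ∪ C, R.piecewise (0 : α → M) x v = ∑ c ∈ C, x c := by
  rw [sum_piecewise, union_sdiff_cancel_left hRC]
  simp

theorem sum_card_filter_lt {α M : Type*} [LinearOrder α] [AddCommMonoid M] (f : ℕ → M)
    (R : Finset α) : ∑ r ∈ R, f #{s ∈ R | s < r} = ∑ i ∈ range #R, f i := by
  induction R using Finset.induction_on_max with
  | empty => simp
  | insert a R ha ih =>
    have haR : a ∉ R := fun h => (ha a h).false
    have hrank : #{s ∈ insert a R | s < a} = #R := by
      rw [filter_insert, if_neg (lt_irrefl a), filter_true_of_mem ha]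
    rw [sum_insert haR, card_insert_of_notMem haR, sum_range_succ, hrank, add_comm, ← ih]
    congr 1
    refine sum_congr rfl fun r hr => ?_
    rw [filter_insert, if_neg (ha r hr).not_gt]

namespace RootedForest

section Structure

variable {m : ℕ}

theorem wellFounded_parent (F : RootedForest m) :
    WellFounded fun w v => F.parent v = some w := by
  refine ⟨fun v => ?_⟩
  obtain ⟨j, hj⟩ := F.acyclic v
  induction j generalizing v with
  | zero => simp at hj
  | succ j ih =>
    exact ⟨v, fun w hw => ih w (by simpa [Function.iterate_succ_apply, hw] using hj)⟩

/-- The forest with a given well-founded parent function. -/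
def ofWellFounded (p : Fin m → Option (Fin m)) (hp : WellFounded fun w v => p v = some w) :
    RootedForest m where
  parent := p
  acyclic v := by
    induction v using hp.induction with
    | _ v ih =>
      cases hv : p v with
      | none => exact ⟨1, hv⟩
      | some w =>
        obtain ⟨j, hj⟩ := ih w hv
        exact ⟨j + 1, by simpa [Function.iterate_succ_apply, hv] using hj⟩

variable (F : RootedForest m)

theorem mem_roots {v : Fin m} : v ∈ F.roots ↔ F.parent v = none := by
  simp [roots]

theorem mem_rootChildren {v : Fin m} :
    v ∈ F.rootChildren ↔ ∃ r ∈ F.roots, F.parent v = some r := by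
  simp [rootChildren]

theorem rootChildren_subset_compl_roots : F.rootChildren ⊆ F.rootsᶜ := by
  intro v hv
  obtain ⟨r, -, h⟩ := F.mem_rootChildren.1 hv
  simp [mem_roots, h]

theorem isLeaf_of_roots_eq_univ (h : F.roots = univ) (v : Fin m) : F.IsLeaf v := by
  intro w
  simp [F.mem_roots.1 (h ▸ mem_univ w)]

/-- `F.IsDescendant v w` says that iterating `F.parent` from `v` leads to `w`; every vertex is
a descendant of itself. -/
def IsDescendant : Fin m → Fin m → Prop :=
  Relation.ReflTransGen fun v w => F.parent v = some w

theorem exists_root_isDescendant (v : Fin m) : ∃ r ∈ F.roots, F.IsDescendant v r := by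
  induction v using F.wellFounded_parent.induction with
  | _ v ih =>
    cases hv : F.parent v with
    | none => exact ⟨v, F.mem_roots.2 hv, .refl⟩
    | some w =>
      obtain ⟨r, hr, hwr⟩ := ih w hv
      exact ⟨r, hr, hwr.head hv⟩

variable {F}

theorem IsDescendant.eq_of_mem_roots {r s : Fin m} (h : F.IsDescendant r s) (hr : r ∈ F.roots) :
    r = s := by
  obtain rfl | ⟨w, hw, -⟩ := h.cases_head
  · rfl
  · simp [F.mem_roots.1 hr] at hw

theorem graph_adj_of_parent_eq {v w : Fin m} (h : F.parent v = some w) : F.graph.Adj v w := by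
  refine (SimpleGraph.fromRel_adj _ _ _).2 ⟨?_, .inl h⟩
  rintro rfl
  exact F.wellFounded_parent.irrefl.irrefl v h

theorem IsDescendant.reachable {v w : Fin m} (h : F.IsDescendant v w) : F.graph.Reachable v w := by
  induction h with
  | refl => exact .refl _
  | tail _ h ih => exact ih.trans (graph_adj_of_parent_eq h).reachable

theorem IsDescendant.of_adj {v w r : Fin m} (h : F.IsDescendant v r) (hr : r ∈ F.roots)
    (hvw : F.graph.Adj v w) : F.IsDescendant w r := by
  obtain ⟨-, hw | hv⟩ := (SimpleGraph.fromRel_adj _ _ _).1 hvw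
  · obtain rfl | ⟨w', hw', hr'⟩ := h.cases_head
    · simp [F.mem_roots.1 hr] at hw
    · obtain rfl : w' = w := Option.some.inj (hw'.symm.trans hw)
      exact hr'
  · exact h.head hv

theorem IsDescendant.of_reachable {v w r : Fin m} (h : F.IsDescendant v r) (hr : r ∈ F.roots)
    (hvw : F.graph.Reachable v w) : F.IsDescendant w r := by
  obtain ⟨p⟩ := hvw
  induction p with
  | nil => exact h
  | cons hadj _ ih => exact ih (h.of_adj hr hadj)

variable (F)

theorem numComponents_eq_card_roots : F.numComponents = #F.roots := by
  rw [numComponents, ← Nat.card_eq_finsetCard]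
  refine (Nat.card_eq_of_bijective
    (fun r : F.roots => F.graph.connectedComponentMk r) ⟨fun r s h => ?_, fun c => ?_⟩).symm
  · have hsr : F.IsDescendant s r := IsDescendant.of_reachable .refl r.2
      (SimpleGraph.ConnectedComponent.exact h)
    exact Subtype.ext (hsr.eq_of_mem_roots s.2).symm
  · induction c using SimpleGraph.ConnectedComponent.ind with
    | _ v =>
      obtain ⟨r, hr, hvr⟩ := F.exists_root_isDescendant v
      exact ⟨⟨r, hr⟩, SimpleGraph.ConnectedComponent.sound hvr.reachable.symm⟩

theorem rootChildren_nonempty (h : F.rootsᶜ.Nonempty) : F.rootChildren.Nonempty := by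
  obtain ⟨v, hv⟩ := h
  obtain ⟨r, hr, hvr⟩ := F.exists_root_isDescendant v
  obtain rfl | ⟨c, -, hc⟩ := hvr.cases_tail
  · exact absurd hr (mem_compl.1 hv)
  · exact ⟨c, F.mem_rootChildren.2 ⟨r, hr, hc⟩⟩

theorem smallestRootChild_eq_singleton (h : F.rootChildren.Nonempty) :
    F.smallestRootChild = {F.rootChildren.min' h} := by
  ext v
  simp only [smallestRootChild, mem_filter, mem_singleton]
  exact ⟨fun hv => (min'_eq_iff _ _ _).2 hv |>.symm,
    fun hv => (min'_eq_iff _ _ _).1 hv.symm⟩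

end Structure

section Graft

variable {m : ℕ}

/-- The forest obtained from `G` by hanging each vertex `c` of `C` below the vertex `g c`, which
is a root of `G` outside of `C`. -/
def graft (G : RootedForest m) (C : Finset (Fin m)) (g : C → Fin m)
    (hg : ∀ c, g c ∈ G.roots \ C) : RootedForest m :=
  ofWellFounded (fun v => if hv : v ∈ C then some (g ⟨v, hv⟩) else G.parent v) <| by
    have acc_root (r : Fin m) (hr : r ∈ G.roots \ C) :
        Acc (fun w v => (if hv : v ∈ C then some (g ⟨v, hv⟩) else G.parent v) = some w) r := by
      obtain ⟨hr, hrC⟩ := mem_sdiff.1 hr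
      refine ⟨r, fun w hw => ?_⟩
      simp [hrC, G.mem_roots.1 hr] at hw
    refine ⟨fun v => ?_⟩
    induction v using G.wellFounded_parent.induction with
    | _ v ih =>
      refine ⟨v, fun w hw => ?_⟩
      by_cases hv : v ∈ C
      · obtain rfl : g ⟨v, hv⟩ = w := by simpa [hv] using hw
        exact acc_root _ (hg _)
      · exact ih w (by simpa [hv] using hw)

/-- The forest in which the vertices of `C` are cut off from their parents. -/
def detach (F : RootedForest m) (C : Finset (Fin m)) : RootedForest m :=
  ofWellFounded (fun v => if v ∈ C then none else F.parent v) <|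
    Subrelation.wf (fun {w v} h => by
      by_cases hv : v ∈ C
      · simp [hv] at h
      · simpa [hv] using h) F.wellFounded_parent

section

variable {G : RootedForest m} {C : Finset (Fin m)} {g : C → Fin m}
  {hg : ∀ c, g c ∈ G.roots \ C}

theorem graft_parent_of_mem {v : Fin m} (hv : v ∈ C) :
    (G.graft C g hg).parent v = some (g ⟨v, hv⟩) :=
  dif_pos hv

theorem graft_parent_of_notMem {v : Fin m} (hv : v ∉ C) :
    (G.graft C g hg).parent v = G.parent v :=
  dif_neg hv

theorem roots_graft : (G.graft C g hg).roots = G.roots \ C := by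
  ext v
  by_cases hv : v ∈ C
  · simp [mem_roots, graft_parent_of_mem, hv]
  · simp [mem_roots, graft_parent_of_notMem, hv]

theorem rootChildren_graft (hG : ∀ r ∈ G.roots \ C, G.IsLeaf r) :
    (G.graft C g hg).rootChildren = C := by
  ext v
  rw [mem_rootChildren, roots_graft]
  by_cases hv : v ∈ C
  · simp only [graft_parent_of_mem hv, hv, iff_true]
    exact ⟨_, hg _, rfl⟩
  · simp only [graft_parent_of_notMem hv, hv, iff_false]
    rintro ⟨r, hr, h⟩
    exact hG r hr v h

end

section

variable (F : RootedForest m) {C : Finset (Fin m)} {v : Fin m}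

theorem detach_parent_of_mem (hv : v ∈ C) : (F.detach C).parent v = none :=
  if_pos hv

theorem detach_parent_of_notMem (hv : v ∉ C) : (F.detach C).parent v = F.parent v :=
  if_neg hv

end

theorem detach_graft {G : RootedForest m} {C : Finset (Fin m)} {g : C → Fin m}
    {hg : ∀ c, g c ∈ G.roots \ C} (hC : C ⊆ G.roots) : (G.graft C g hg).detach C = G := by
  ext1
  funext v
  by_cases hv : v ∈ C
  · rw [detach_parent_of_mem _ hv, G.mem_roots.1 (hC hv)]
  · rw [detach_parent_of_notMem _ hv, graft_parent_of_notMem hv]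

theorem roots_detach (F : RootedForest m) (C : Finset (Fin m)) :
    (F.detach C).roots = F.roots ∪ C := by
  ext v
  by_cases hv : v ∈ C <;>
    simp [mem_roots, detach_parent_of_mem, detach_parent_of_notMem, hv]

theorem isLeaf_detach_rootChildren (F : RootedForest m) {r : Fin m} (hr : r ∈ F.roots) :
    (F.detach F.rootChildren).IsLeaf r := by
  intro v hv
  by_cases hvC : v ∈ F.rootChildren
  · simp [detach_parent_of_mem, hvC] at hv
  · rw [detach_parent_of_notMem _ hvC] at hv
    exact hvC (F.mem_rootChildren.2 ⟨r, hr, hv⟩)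

theorem exists_graft_detach_rootChildren (F : RootedForest m) :
    ∃ (g : F.rootChildren → Fin m)
      (hg : ∀ c, g c ∈ (F.detach F.rootChildren).roots \ F.rootChildren),
      (F.detach F.rootChildren).graft F.rootChildren g hg = F := by
  choose g hgroot hgparent using fun c : F.rootChildren => F.mem_rootChildren.1 c.2
  have hg (c : F.rootChildren) :
      g c ∈ (F.detach F.rootChildren).roots \ F.rootChildren := by
    rw [roots_detach, mem_sdiff, mem_union]
    exact ⟨.inl (hgroot c), fun h =>
      mem_compl.1 (F.rootChildren_subset_compl_roots h) (hgroot c)⟩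
  refine ⟨g, hg, RootedForest.ext (funext fun v => ?_)⟩
  by_cases hv : v ∈ F.rootChildren
  · rw [graft_parent_of_mem hv, hgparent ⟨v, hv⟩]
  · rw [graft_parent_of_notMem hv, detach_parent_of_notMem _ hv]

end Graft

section EdgeProd

variable {m : ℕ} {K : Type*} [CommSemiring K]

/-- The weight of the forest `F` when an edge from a vertex `v` to its parent `p` has
weight `W v p`. -/
def edgeProd (F : RootedForest m) (W : Fin m → Fin m → K) : K :=
  ∏ v, (F.parent v).elim 1 (W v)

theorem edgeProd_congr {F : RootedForest m} {W W' : Fin m → Fin m → K}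
    (h : ∀ v p, F.parent v = some p → W v p = W' v p) : F.edgeProd W = F.edgeProd W' := by
  refine prod_congr rfl fun v _ => ?_
  cases hv : F.parent v with
  | none => rfl
  | some p => exact h v p hv

theorem edgeProd_of_roots_eq_univ {F : RootedForest m} (hF : F.roots = univ)
    (W : Fin m → Fin m → K) : F.edgeProd W = 1 :=
  prod_eq_one fun v _ => by simp [F.mem_roots.1 (hF ▸ mem_univ v)]

theorem edgeProd_graft {G : RootedForest m} {C : Finset (Fin m)} {g : C → Fin m}
    {hg : ∀ c, g c ∈ G.roots \ C} (hC : C ⊆ G.roots) (W : Fin m → Fin m → K) :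
    (G.graft C g hg).edgeProd W = (∏ c : C, W c (g c)) * G.edgeProd W := by
  have hgrafted : ∏ v ∈ C, ((G.graft C g hg).parent v).elim 1 (W v) = ∏ c : C, W c (g c) := by
    rw [← prod_coe_sort]
    exact prod_congr rfl fun c _ => by rw [graft_parent_of_mem c.2, Option.elim_some]
  have hroots : ∏ v ∈ C, (G.parent v).elim 1 (W v) = 1 :=
    prod_eq_one fun v hv => by rw [G.mem_roots.1 (hC hv), Option.elim_none]
  have hrest : ∏ v ∈ Cᶜ, ((G.graft C g hg).parent v).elim 1 (W v) =
      ∏ v ∈ Cᶜ, (G.parent v).elim 1 (W v) :=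
    prod_congr rfl fun v hv => by rw [graft_parent_of_notMem (mem_compl.1 hv)]
  rw [edgeProd, edgeProd, ← prod_mul_prod_compl C, hgrafted, hrest,
    ← prod_mul_prod_compl C fun v => (G.parent v).elim 1 (W v), hroots, one_mul]

theorem edgeProd_piecewise_zero (F : RootedForest m) (S : Finset (Fin m))
    [Decidable (∀ r ∈ S, F.IsLeaf r)] (W : Fin m → Fin m → K) :
    F.edgeProd (fun v => S.piecewise 0 (W v)) =
      if ∀ r ∈ S, F.IsLeaf r then F.edgeProd W else 0 := by
  split_ifs with hS
  · exact edgeProd_congr fun v p hv =>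
      piecewise_eq_of_notMem _ _ _ fun hp => hS p hp v hv
  · simp only [IsLeaf, not_forall, not_not] at hS
    obtain ⟨r, hr, v, hv⟩ := hS
    exact prod_eq_zero (mem_univ v) (by simp [hv, hr])

theorem sum_edgeProd_roots_rootChildren {R C : Finset (Fin m)} (hRC : Disjoint R C)
    (W : Fin m → Fin m → K) :
    ∑ F : RootedForest m with F.roots = R ∧ F.rootChildren = C, F.edgeProd W =
      (∏ c ∈ C, ∑ r ∈ R, W c r) *
        ∑ G : RootedForest m with G.roots = R ∪ C, G.edgeProd fun v => R.piecewise 0 (W v) := by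
  classical
  simp only [edgeProd_piecewise_zero]
  rw [← sum_filter, filter_filter, ← prod_coe_sort, prod_univ_sum, sum_mul_sum, ← sum_product']
  have hsdiff : (R ∪ C) \ C = R := union_sdiff_cancel_right hRC
  have mem_product_iff {a : (C → Fin m) × RootedForest m} :
      a ∈ (Fintype.piFinset fun _ : C => R) ×ˢ
          (univ.filter fun G : RootedForest m => G.roots = R ∪ C ∧ ∀ r ∈ R, G.IsLeaf r) ↔
        (∀ c, a.1 c ∈ R) ∧ a.2.roots = R ∪ C ∧ ∀ r ∈ R, a.2.IsLeaf r := by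
    simp
  symm
  refine sum_bij (fun a ha => a.2.graft C a.1 fun c => ?_) ?_ ?_ ?_ ?_
  · obtain ⟨hg, hG, -⟩ := mem_product_iff.1 ha
    rw [hG, hsdiff]
    exact hg c
  · rintro ⟨g, G⟩ ha
    obtain ⟨-, hG, hleaf⟩ := mem_product_iff.1 ha
    refine mem_filter.2 ⟨mem_univ _, by rw [roots_graft, hG, hsdiff], rootChildren_graft ?_⟩
    rwa [hG, hsdiff]
  · rintro ⟨g, G⟩ ha ⟨g', G'⟩ ha' h
    obtain ⟨-, hG, -⟩ := mem_product_iff.1 ha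
    obtain ⟨-, hG', -⟩ := mem_product_iff.1 ha'
    refine Prod.ext (funext fun c => ?_) ?_
    · simpa [graft_parent_of_mem c.2] using congrArg (fun F => F.parent c) h
    · simpa [detach_graft, hG, hG'] using congrArg (fun F => F.detach C) h
  · intro F hF
    obtain ⟨rfl, rfl⟩ := (mem_filter.1 hF).2
    obtain ⟨g, hg, hgF⟩ := F.exists_graft_detach_rootChildren
    refine ⟨(g, F.detach F.rootChildren), mem_product_iff.2 ⟨fun c => ?_, F.roots_detach _,
      fun r => F.isLeaf_detach_rootChildren⟩, hgF⟩
    simpa only [roots_detach, hsdiff] using hg c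
  · rintro ⟨g, G⟩ ha
    obtain ⟨-, hG, -⟩ := mem_product_iff.1 ha
    exact (edgeProd_graft (hG ▸ subset_union_right) W).symm

/-- The total weight of the forests with root set `R` when an edge from a vertex to its parent `p`
has weight `x p`. -/
noncomputable def forestSum (x : Fin m → K) (R : Finset (Fin m)) : K :=
  ∑ F : RootedForest m with F.roots = R, F.edgeProd fun _ => x

theorem forestSum_univ (x : Fin m → K) : forestSum x univ = 1 := by
  let F : RootedForest m := ⟨fun _ => none, fun _ => ⟨1, rfl⟩⟩
  have hF : F.roots = univ := by
    ext v
    simp [mem_roots, F]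
  have hunique : ({G : RootedForest m | G.roots = univ} : Finset _) = {F} := by
    refine eq_singleton_iff_unique_mem.2 ⟨by simpa using hF, fun G hG => ?_⟩
    exact RootedForest.ext (funext fun v => G.mem_roots.1 ((mem_filter.1 hG).2 ▸ mem_univ v))
  rw [forestSum, hunique, sum_singleton, edgeProd_of_roots_eq_univ hF]

/-- The total weight of the forests with root set `R ≠ univ`, sorted by the number `j + 1` and the
set `C` of the children of the roots, when the edge above the smallest of these is left out. The
weight `R.piecewise 0 x` keeps the vertices of `R` isolated once `C` is cut off. -/
noncomputable def reducedForestSum (x : Fin m → K) (R : Finset (Fin m)) : K :=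
  ∑ j ∈ range #Rᶜ, (∑ r ∈ R, x r) ^ j *
    ∑ C ∈ powersetCard (j + 1) Rᶜ, forestSum (R.piecewise 0 x) (R ∪ C)

theorem sum_edgeProd_smallestRootChild_of_rootChildren {R C : Finset (Fin m)} (hRC : Disjoint R C)
    (hC : C.Nonempty) (x z : Fin m → K) :
    ∑ F : RootedForest m with F.roots = R ∧ F.rootChildren = C,
        F.edgeProd (fun v => if v ∈ F.smallestRootChild then z else x) =
      (∑ r ∈ R, z r) * ((∑ r ∈ R, x r) ^ (#C - 1) * forestSum (R.piecewise 0 x) (R ∪ C)) := by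
  set W : Fin m → Fin m → K := fun v => if v = C.min' hC then z else x
  have hW (F : RootedForest m) (hF : F ∈ univ.filter fun F => F.roots = R ∧ F.rootChildren = C) :
      F.edgeProd (fun v => if v ∈ F.smallestRootChild then z else x) = F.edgeProd W := by
    obtain ⟨-, rfl⟩ := (mem_filter.1 hF).2
    simp [W, F.smallestRootChild_eq_singleton hC]
  have hprod : ∏ c ∈ C, ∑ r ∈ R, W c r = (∑ r ∈ R, z r) * (∑ r ∈ R, x r) ^ (#C - 1) := by
    rw [← mul_prod_erase C _ (C.min'_mem hC), ← card_erase_of_mem (C.min'_mem hC)]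
    congr 1
    · simp [W]
    · exact prod_eq_pow_card fun c hc => by simp [W, ne_of_mem_erase hc]
  rw [sum_congr rfl hW, sum_edgeProd_roots_rootChildren hRC, hprod, mul_assoc, forestSum]
  congr 2
  refine sum_congr rfl fun G hG => edgeProd_congr fun v p hv => ?_
  have hvC : v ≠ C.min' hC := by
    rintro rfl
    have hmin : C.min' hC ∈ G.roots := by
      rw [(mem_filter.1 hG).2]
      exact mem_union_right R (C.min'_mem hC)
    simp [G.mem_roots.1 hmin] at hv
  simp [W, hvC]

theorem sum_edgeProd_smallestRootChild_eq_mul_reducedForestSum {R : Finset (Fin m)}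
    (hR : Rᶜ.Nonempty) (x z : Fin m → K) :
    ∑ F : RootedForest m with F.roots = R,
        F.edgeProd (fun v => if v ∈ F.smallestRootChild then z else x) =
      (∑ r ∈ R, z r) * reducedForestSum x R := by
  have hmaps (F : RootedForest m) (hF : F ∈ univ.filter fun F => F.roots = R) :
      F.rootChildren ∈ Rᶜ.powerset := by
    rw [mem_powerset, ← (mem_filter.1 hF).2]
    exact F.rootChildren_subset_compl_roots
  have hempty : ({F : RootedForest m | F.roots = R ∧ F.rootChildren = ∅} : Finset _) = ∅ := by
    refine filter_false_of_mem fun F _ ⟨hFR, hF⟩ => ?_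
    exact (F.rootChildren_nonempty (hFR ▸ hR)).ne_empty hF
  rw [← sum_fiberwise_of_maps_to hmaps, sum_powerset, sum_range_succ', powersetCard_zero,
    sum_singleton]
  simp only [filter_filter]
  rw [hempty, sum_empty, add_zero, reducedForestSum, mul_sum]
  refine sum_congr rfl fun j _ => ?_
  rw [mul_sum, mul_sum]
  refine sum_congr rfl fun C hC => ?_
  obtain ⟨hCR, hcard⟩ := mem_powersetCard.1 hC
  rw [sum_edgeProd_smallestRootChild_of_rootChildren (disjoint_compl_right.mono_right hCR)
    (card_pos.1 (by lia)), hcard, Nat.add_sub_cancel]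

theorem forestSum_eq_mul_reducedForestSum {R : Finset (Fin m)} (hR : Rᶜ.Nonempty)
    (x : Fin m → K) : forestSum x R = (∑ r ∈ R, x r) * reducedForestSum x R := by
  rw [← sum_edgeProd_smallestRootChild_eq_mul_reducedForestSum hR, forestSum]
  simp only [ite_self]

theorem reducedForestSum_eq_pow (x : Fin m → K) {R : Finset (Fin m)} (hR : Rᶜ.Nonempty) :
    reducedForestSum x R = (∑ v, x v) ^ (#Rᶜ - 1) := by
  induction hn : #Rᶜ using Nat.strong_induction_on generalizing x R with
  | _ n ih =>
    obtain ⟨s, rfl⟩ : ∃ s, n = s + 1 := Nat.exists_eq_succ_of_ne_zero (hn ▸ hR.card_ne_zero)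
    set a := ∑ r ∈ R, x r
    set b := ∑ v ∈ Rᶜ, x v
    have htop : ∑ C ∈ powersetCard (s + 1) Rᶜ, forestSum (R.piecewise 0 x) (R ∪ C) = 1 := by
      rw [← hn, powersetCard_self, sum_singleton, union_compl, forestSum_univ]
    have hlayer (j : ℕ) (hj : j < s) :
        ∑ C ∈ powersetCard (j + 1) Rᶜ, forestSum (R.piecewise 0 x) (R ∪ C) =
          b ^ (s - j) * s.choose j := by
      have hterm (C : Finset (Fin m)) (hC : C ∈ powersetCard (j + 1) Rᶜ) :
          forestSum (R.piecewise 0 x) (R ∪ C) = (∑ c ∈ C, x c) * b ^ (s - j - 1) := by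
        obtain ⟨hCR, hcard⟩ := mem_powersetCard.1 hC
        have hcompl : #(R ∪ C)ᶜ = s - j := by
          rw [compl_union, ← sdiff_eq_inter_compl, card_sdiff_of_subset hCR]
          lia
        have hne : (R ∪ C)ᶜ.Nonempty := card_pos.1 (by lia)
        have htotal : ∑ v, R.piecewise 0 x v = b := by
          rw [← union_compl R, sum_union_piecewise_zero disjoint_compl_right]
        rw [forestSum_eq_mul_reducedForestSum hne, ih (s - j) (by lia) _ hne hcompl, htotal,
          sum_union_piecewise_zero (disjoint_compl_right.mono_right hCR)]
      rw [sum_congr rfl hterm, ← sum_mul, sum_powersetCard_succ_sum, hn, Nat.add_sub_cancel,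
        nsmul_eq_mul, mul_assoc, ← pow_succ', Nat.sub_add_cancel (by lia), mul_comm]
    rw [reducedForestSum, hn, sum_range_succ, htop, Nat.add_sub_cancel,
      ← sum_add_sum_compl R, add_pow, sum_range_succ]
    congr 1
    · exact sum_congr rfl fun j hj => by rw [hlayer j (mem_range.1 hj), mul_assoc]
    · simp

theorem sum_edgeProd_smallestRootChild {R : Finset (Fin m)} (hR : Rᶜ.Nonempty)
    (x z : Fin m → K) :
    ∑ F : RootedForest m with F.roots = R,
        F.edgeProd (fun v => if v ∈ F.smallestRootChild then z else x) =
      (∑ r ∈ R, z r) * (∑ v, x v) ^ (#Rᶜ - 1) := by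
  rw [sum_edgeProd_smallestRootChild_eq_mul_reducedForestSum hR, reducedForestSum_eq_pow x hR]

end EdgeProd

section Statistics

variable {m : ℕ} (F : RootedForest m)

theorem notMem_roots_of_mem_smallestRootChild {v : Fin m} (hv : v ∈ F.smallestRootChild) :
    v ∉ F.roots :=
  mem_compl.1 (F.rootChildren_subset_compl_roots (mem_filter.1 hv).1)

theorem pow_scindex_add_eq_edgeProd {K : Type*} [CommSemiring K] (q : K) :
    q ^ (F.scindex + ∑ v ∈ F.remaining, (F.parentLabel v - 1)) =
      F.edgeProd fun v => if v ∈ F.smallestRootChild then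
        fun p => q ^ #{r ∈ F.roots | r < p} else fun p => q ^ (p : ℕ) := by
  rw [scindex, ← univ_inter F.smallestRootChild, ← univ_inter F.remaining, ← sum_ite_mem,
    ← sum_ite_mem, ← sum_add_distrib, ← prod_pow_eq_pow_sum, edgeProd]
  refine prod_congr rfl fun v _ => ?_
  cases hv : F.parent v with
  | none =>
    have hroot : v ∈ F.roots := F.mem_roots.2 hv
    have hmin : v ∉ F.smallestRootChild := fun h => F.notMem_roots_of_mem_smallestRootChild h hroot
    simp [remaining, hroot, hmin]
  | some p =>
    have hroot : v ∉ F.roots := by simp [mem_roots, hv]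
    by_cases hmin : v ∈ F.smallestRootChild <;> simp [remaining, parentLabel, hroot, hmin, hv]

theorem card_remaining : #F.remaining = #F.rootsᶜ - 1 := by
  have hsdiff : F.remaining = F.rootsᶜ \ F.smallestRootChild := by
    ext v
    simp [remaining]
  have hsub : F.smallestRootChild ⊆ F.rootsᶜ :=
    (filter_subset _ _).trans F.rootChildren_subset_compl_roots
  rw [hsdiff, card_sdiff_of_subset hsub]
  obtain h | h := F.rootsᶜ.eq_empty_or_nonempty
  · simp [h]
  · rw [F.smallestRootChild_eq_singleton (F.rootChildren_nonempty h), card_singleton]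

theorem parents_eq_sum_add_card_remaining :
    F.parents = ∑ v ∈ F.remaining, (F.parentLabel v - 1) + #F.remaining := by
  rw [parents, card_eq_sum_ones, ← sum_add_distrib]
  refine sum_congr rfl fun v hv => (Nat.sub_add_cancel ?_).symm
  cases hp : F.parent v with
  | none => simp [remaining, mem_roots, hp] at hv
  | some w => simp [parentLabel, hp]

end Statistics

section LeafSum

variable {n : ℕ} {K : Type*} [CommSemiring K]
  [DecidablePred fun F : RootedForest (n + 1) => F.IsLeaf (Fin.last n)]

theorem sum_pow_scindex_add (q : K) {R : Finset (Fin (n + 1))} (hR : Rᶜ.Nonempty) :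
    ∑ F : RootedForest (n + 1) with F.roots = R ∧ F.IsLeaf (Fin.last n),
        q ^ (F.scindex + ∑ v ∈ F.remaining, (F.parentLabel v - 1)) =
      (∑ i ∈ range #(R.erase (Fin.last n)), q ^ i) * (∑ i ∈ range n, q ^ i) ^ (#Rᶜ - 1) := by
  classical
  set L : Finset (Fin (n + 1)) := {Fin.last n}
  set x : Fin (n + 1) → K := L.piecewise 0 fun p => q ^ (p : ℕ)
  set z : Fin (n + 1) → K := L.piecewise 0 fun p => q ^ #{r ∈ R | r < p}
  have hx : ∑ v, x v = ∑ i ∈ range n, q ^ i := by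
    simp [x, L, Fin.sum_univ_castSucc, Fin.castSucc_ne_last, Fin.sum_univ_eq_sum_range]
  have hz : ∑ r ∈ R, z r = ∑ i ∈ range #(R.erase (Fin.last n)), q ^ i := by
    rw [← sum_card_filter_lt (q ^ ·), sum_piecewise, sdiff_singleton_eq_erase]
    simp only [Pi.zero_apply, sum_const_zero, zero_add]
    refine sum_congr rfl fun r _ => ?_
    congr 2
    ext s
    simp only [mem_filter, mem_erase, and_congr_left_iff]
    exact fun hs => ⟨fun h => ⟨(hs.trans_le (Fin.le_last r)).ne, h⟩, fun h => h.2⟩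
  rw [← hx, ← hz, ← sum_edgeProd_smallestRootChild hR, ← filter_filter, sum_filter]
  refine sum_congr rfl fun F hF => ?_
  obtain rfl := (mem_filter.1 hF).2
  have hweight := F.edgeProd_piecewise_zero L fun v => if v ∈ F.smallestRootChild then
    fun p => q ^ #{r ∈ F.roots | r < p} else fun p => q ^ (p : ℕ)
  rw [← pow_scindex_add_eq_edgeProd] at hweight
  simp only [L, mem_singleton, forall_eq] at hweight
  rw [← hweight]
  congr 1
  funext v
  split_ifs <;> rfl

theorem sum_pow_scindex_add_univ (q : K) :
    ∑ F : RootedForest (n + 1) with F.roots = univ ∧ F.IsLeaf (Fin.last n),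
      q ^ (F.scindex + ∑ v ∈ F.remaining, (F.parentLabel v - 1)) = 1 := by
  rw [← forestSum_univ (0 : Fin (n + 1) → K), forestSum]
  refine sum_congr (filter_congr fun F _ => ?_) fun F hF => ?_
  · exact and_iff_left_of_imp fun hF => F.isLeaf_of_roots_eq_univ hF _
  · have hroots := (mem_filter.1 hF).2
    rw [pow_scindex_add_eq_edgeProd, edgeProd_of_roots_eq_univ hroots,
      edgeProd_of_roots_eq_univ hroots]

end LeafSum
end RootedForest

section QAnalogues

theorem qInt_add (a b : ℕ) : qInt (a + b) = qInt a + RatFunc.X ^ a * qInt b := by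
  simp only [qInt, sum_range_add, pow_add, mul_sum]

theorem qInt_succ_ne_zero (n : ℕ) : qInt (n + 1) ≠ 0 := by
  have hpoly : qInt (n + 1) =
      algebraMap (Polynomial ℚ) (RatFunc ℚ) (∑ i ∈ range (n + 1), Polynomial.X ^ i) := by
    simp [qInt]
  rw [hpoly, Ne, FaithfulSMul.algebraMap_eq_zero_iff]
  intro hzero
  have heval := congrArg (Polynomial.eval 1) hzero
  simp only [Polynomial.eval_finsetSum, Polynomial.eval_pow, Polynomial.eval_X, one_pow,
    sum_const, card_range, nsmul_eq_mul, mul_one, Polynomial.eval_zero] at heval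
  exact n.succ_ne_zero (by exact_mod_cast heval)

theorem qFactorial_zero : qFactorial 0 = 1 := by simp [qFactorial]

theorem qFactorial_succ (n : ℕ) : qFactorial (n + 1) = qFactorial n * qInt (n + 1) := by
  rw [qFactorial, prod_Icc_succ_top n.succ_pos', qFactorial]

theorem qFactorial_ne_zero (n : ℕ) : qFactorial n ≠ 0 := by
  induction n with
  | zero => simp [qFactorial_zero]
  | succ n ih =>
    rw [qFactorial_succ]
    exact mul_ne_zero ih (qInt_succ_ne_zero n)

theorem qBinomial_add_left (a b : ℕ) :
    qBinomial (a + b) a = qFactorial (a + b) / (qFactorial a * qFactorial b) := by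
  rw [qBinomial, if_pos (Nat.le_add_right a b), Nat.add_sub_cancel_left]

theorem qBinomial_eq_zero_of_lt {n k : ℕ} (h : n < k) : qBinomial n k = 0 :=
  if_neg h.not_ge

theorem qBinomial_self (n : ℕ) : qBinomial n n = 1 := by
  simpa [qFactorial_zero, qFactorial_ne_zero] using qBinomial_add_left n 0

theorem qBinomial_zero_right (n : ℕ) : qBinomial n 0 = 1 := by
  simpa [qFactorial_zero, qFactorial_ne_zero] using qBinomial_add_left 0 n

theorem qInt_mul_qBinomial_succ (n k : ℕ) :
    qInt (k + 1) * qBinomial n (k + 1) = qInt (n - k) * qBinomial n k := by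
  obtain h | h := lt_or_ge k n
  · obtain ⟨b, rfl⟩ := Nat.exists_eq_add_of_le' h
    have hleft := qBinomial_add_left (k + 1) b
    have hright := qBinomial_add_left k (b + 1)
    rw [show k + 1 + b = b + (k + 1) by ring] at hleft
    rw [show k + (b + 1) = b + (k + 1) by ring] at hright
    rw [hleft, hright, show b + (k + 1) - k = b + 1 by lia, qFactorial_succ k, qFactorial_succ b]
    have hk := qFactorial_ne_zero k
    have hb := qFactorial_ne_zero b
    have hk' := qInt_succ_ne_zero k
    have hb' := qInt_succ_ne_zero b
    field_simp
  · simp [qBinomial_eq_zero_of_lt (Nat.lt_succ_of_le h), Nat.sub_eq_zero_of_le h, qInt]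

theorem qInt_mul_qBinomial_eq_add {n k : ℕ} (h : k ≤ n) :
    qInt n * qBinomial n k =
      qInt (k + 1) * qBinomial n (k + 1) + RatFunc.X ^ (n - k) * (qInt k * qBinomial n k) := by
  have hn := qInt_add (n - k) k
  rw [Nat.sub_add_cancel h] at hn
  rw [qInt_mul_qBinomial_succ, hn]
  ring

theorem qBinomial_succ_succ {n k : ℕ} (h : k ≤ n) :
    qBinomial (n + 1) (k + 1) = qBinomial n (k + 1) + RatFunc.X ^ (n - k) * qBinomial n k := by
  have hsucc : qInt (k + 1) * qBinomial (n + 1) (k + 1) = qInt (n + 1) * qBinomial n k := by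
    obtain ⟨b, rfl⟩ := Nat.exists_eq_add_of_le h
    have hadd := qBinomial_add_left (k + 1) b
    rw [show k + 1 + b = k + b + 1 by ring] at hadd
    rw [hadd, qBinomial_add_left, qFactorial_succ, qFactorial_succ]
    have hk := qInt_succ_ne_zero k
    field_simp
  have hn := qInt_add (n - k) (k + 1)
  rw [← add_assoc, Nat.sub_add_cancel h] at hn
  refine mul_left_cancel₀ (qInt_succ_ne_zero k) ?_
  rw [hsucc, mul_add, qInt_mul_qBinomial_succ, hn]
  ring

end QAnalogues

section Inversions

theorem sum_powersetCard_succ_insert {α M : Type*} [DecidableEq α] [AddCommMonoid M]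
    {a : α} {S : Finset α} (ha : a ∉ S) (k : ℕ) (f : Finset α → M) :
    ∑ R ∈ powersetCard (k + 1) (insert a S), f R =
      ∑ R ∈ powersetCard (k + 1) S, f R + ∑ R ∈ powersetCard k S, f (insert a R) := by
  have hnot {l : ℕ} {R : Finset α} (hR : R ∈ powersetCard l S) : a ∉ R :=
    fun h => ha ((mem_powersetCard.1 hR).1 h)
  rw [powersetCard_succ_insert ha, sum_union, sum_image]
  · intro R hR T hT h
    rw [← erase_insert (hnot hR), h, erase_insert (hnot hT)]
  · refine disjoint_left.2 fun R hR hR' => ?_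
    obtain ⟨T, -, rfl⟩ := mem_image.1 hR'
    exact hnot hR (mem_insert_self a T)

variable {α : Type*} [LinearOrder α]

/-- The number of pairs of an element of `R` and a smaller element of `S \ R`. -/
def inversions (S R : Finset α) : ℕ :=
  ∑ v ∈ R, #{w ∈ S \ R | w < v}

variable {a : α} {S R : Finset α}

theorem inversions_insert_left (ha : ∀ s ∈ S, s < a) (hR : R ⊆ S) :
    inversions (insert a S) R = inversions S R := by
  refine sum_congr rfl fun v hv => ?_
  congr 1
  ext w
  simp only [mem_filter, mem_sdiff, mem_insert]
  have := ha v (hR hv)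
  grind

theorem inversions_insert_insert (ha : ∀ s ∈ S, s < a) (hR : R ⊆ S) :
    inversions (insert a S) (insert a R) = inversions S R + (#S - #R) := by
  have haS : a ∉ S := fun h => (ha a h).false
  have hsdiff : insert a S \ insert a R = S \ R := by
    rw [insert_sdiff_insert, sdiff_insert_of_notMem haS]
  rw [inversions, hsdiff, sum_insert fun h => haS (hR h), add_comm, inversions,
    filter_true_of_mem fun w hw => ha w (mem_sdiff.1 hw).1, card_sdiff_of_subset hR]

theorem sum_pow_inversions_insert_mul {K : Type*} [CommSemiring K] (q : K)
    (ha : ∀ s ∈ S, s < a) (k : ℕ) (f : Finset α → K) :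
    ∑ R ∈ powersetCard (k + 1) (insert a S), q ^ inversions (insert a S) R * f (R.erase a) =
      ∑ R ∈ powersetCard (k + 1) S, q ^ inversions S R * f R +
        q ^ (#S - k) * ∑ R ∈ powersetCard k S, q ^ inversions S R * f R := by
  have haS : a ∉ S := fun h => (ha a h).false
  rw [sum_powersetCard_succ_insert haS, mul_sum]
  congr 1
  · refine sum_congr rfl fun R hR => ?_
    have hRS := (mem_powersetCard.1 hR).1
    rw [inversions_insert_left ha hRS, erase_eq_of_notMem fun h => haS (hRS h)]
  · refine sum_congr rfl fun R hR => ?_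
    obtain ⟨hRS, hcard⟩ := mem_powersetCard.1 hR
    rw [inversions_insert_insert ha hRS, erase_insert fun h => haS (hRS h), hcard, pow_add]
    ring

theorem sum_pow_inversions (S : Finset α) (k : ℕ) :
    ∑ R ∈ powersetCard k S, (RatFunc.X : RatFunc ℚ) ^ inversions S R = qBinomial #S k := by
  induction S using Finset.induction_on_max generalizing k with
  | empty =>
    cases k with
    | zero => simp [inversions, qBinomial_zero_right]
    | succ k => rw [powersetCard_eq_empty.2 (by simp), sum_empty, qBinomial_eq_zero_of_lt (by simp)]
  | insert a S ha ih =>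
    rw [card_insert_of_notMem fun h => (ha a h).false]
    cases k with
    | zero => simp [inversions, qBinomial_zero_right]
    | succ k =>
      have hrec := sum_pow_inversions_insert_mul (RatFunc.X : RatFunc ℚ) ha k fun _ => 1
      simp only [mul_one, ih] at hrec
      rw [hrec]
      obtain hk | hk := le_or_gt k #S
      · rw [qBinomial_succ_succ hk]
      · simp [qBinomial_eq_zero_of_lt, hk, hk.trans]

theorem sum_pow_inversions_mul_qInt (ha : ∀ s ∈ S, s < a) {k : ℕ} (hk : k ≤ #S) :
    ∑ R ∈ powersetCard (k + 1) (insert a S),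
        (RatFunc.X : RatFunc ℚ) ^ inversions (insert a S) R * qInt #(R.erase a) =
      qInt #S * qBinomial #S k := by
  have hsum (l : ℕ) : ∑ R ∈ powersetCard l S, (RatFunc.X : RatFunc ℚ) ^ inversions S R * qInt #R =
      qInt l * qBinomial #S l := by
    rw [← sum_pow_inversions, mul_sum]
    refine sum_congr rfl fun R hR => ?_
    rw [(mem_powersetCard.1 hR).2, mul_comm]
  rw [sum_pow_inversions_insert_mul _ ha k fun R => qInt #R, hsum, hsum,
    qInt_mul_qBinomial_eq_add hk]

end Inversions

section LeafForests

namespace RootedForest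

theorem niblings_eq_inversions {m : ℕ} (F : RootedForest m) :
    F.niblings = inversions univ F.roots := by
  refine sum_congr rfl fun v _ => congrArg card ?_
  ext w
  simp [lowerNonroots]

theorem exponent_eq {n k : ℕ} {F : RootedForest (n + 1)} (hF : #F.roots = k + 1) :
    (F.niblings : ℤ) + (F.scindex : ℤ) + (F.parents : ℤ) - max ((n : ℤ) - (k : ℤ) - 1) 0 =
      ((inversions univ F.roots +
        (F.scindex + ∑ v ∈ F.remaining, (F.parentLabel v - 1)) : ℕ) : ℤ) := by
  have hcard : #F.remaining = n - k - 1 := by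
    rw [card_remaining, card_compl, Fintype.card_fin, hF, Nat.add_sub_add_right]
  have hparents := F.parents_eq_sum_add_card_remaining
  rw [← niblings_eq_inversions]
  generalize ∑ v ∈ F.remaining, (F.parentLabel v - 1) = t at hparents ⊢
  lia

end RootedForest

open RootedForest

open Classical in
theorem sum_leafForests_eq_sum_roots (n k : ℕ) :
    ∑ F ∈ leafForests n k, (RatFunc.X : RatFunc ℚ) ^
        ((F.niblings : ℤ) + (F.scindex : ℤ) + (F.parents : ℤ) - max ((n : ℤ) - (k : ℤ) - 1) 0) =
      ∑ R ∈ powersetCard (k + 1) univ, RatFunc.X ^ inversions univ R *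
        ∑ F : RootedForest (n + 1) with F.roots = R ∧ F.IsLeaf (Fin.last n),
          RatFunc.X ^ (F.scindex + ∑ v ∈ F.remaining, (F.parentLabel v - 1)) := by
  have hmaps (F : RootedForest (n + 1)) (hF : F ∈ leafForests n k) :
      F.roots ∈ powersetCard (k + 1) univ := by
    rw [mem_powersetCard_univ, ← numComponents_eq_card_roots]
    exact (mem_filter.1 hF).2.1
  rw [← sum_fiberwise_of_maps_to hmaps]
  refine sum_congr rfl fun R hR => ?_
  have hfilter : (leafForests n k).filter (fun F => F.roots = R) =
      univ.filter fun F => F.roots = R ∧ F.IsLeaf (Fin.last n) := by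
    ext F
    simp only [leafForests, mem_filter, mem_univ, true_and, numComponents_eq_card_roots]
    rw [and_right_comm, and_comm (a := #F.roots = _)]
    exact and_congr_left' (and_iff_left_of_imp fun h => h ▸ mem_powersetCard_univ.1 hR)
  rw [hfilter, mul_sum]
  refine sum_congr rfl fun F hF => ?_
  obtain rfl := (mem_filter.1 hF).2.1
  rw [exponent_eq (mem_powersetCard_univ.1 hR), zpow_natCast, pow_add]

theorem sum_leafForests_of_lt {n k : ℕ} (h : k < n) :
    ∑ F ∈ leafForests n k, (RatFunc.X : RatFunc ℚ) ^
        ((F.niblings : ℤ) + (F.scindex : ℤ) + (F.parents : ℤ) - max ((n : ℤ) - (k : ℤ) - 1) 0) =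
      qBinomial n k * qInt n ^ (n - k) := by
  classical
  have hinv : ∑ R ∈ powersetCard (k + 1) univ, (RatFunc.X : RatFunc ℚ) ^ inversions univ R *
      qInt #(R.erase (Fin.last n)) = qInt n * qBinomial n k := by
    have hlast : ∀ s ∈ univ.erase (Fin.last n), s < Fin.last n :=
      fun s hs => Fin.lt_last_iff_ne_last.2 (ne_of_mem_erase hs)
    have hcard : #(univ.erase (Fin.last n)) = n := by simp
    have hsum := sum_pow_inversions_mul_qInt hlast (k := k) (by rw [hcard]; exact h.le)
    rwa [insert_erase (mem_univ _), hcard] at hsum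
  have hterm (R : Finset (Fin (n + 1))) (hR : R ∈ powersetCard (k + 1) univ) :
      ∑ F : RootedForest (n + 1) with F.roots = R ∧ F.IsLeaf (Fin.last n),
          (RatFunc.X : RatFunc ℚ) ^ (F.scindex + ∑ v ∈ F.remaining, (F.parentLabel v - 1)) =
        qInt #(R.erase (Fin.last n)) * qInt n ^ (n - k - 1) := by
    have hcompl : #Rᶜ = n - k := by
      rw [card_compl, Fintype.card_fin, mem_powersetCard_univ.1 hR, Nat.add_sub_add_right]
    rw [sum_pow_scindex_add _ (card_pos.1 (by lia)), hcompl, qInt, qInt]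
  rw [sum_leafForests_eq_sum_roots, sum_congr rfl fun R hR => by rw [hterm R hR, ← mul_assoc],
    ← sum_mul, hinv, mul_right_comm, ← pow_succ', Nat.sub_add_cancel (by lia), mul_comm]

theorem sum_leafForests_self (n : ℕ) :
    ∑ F ∈ leafForests n n, (RatFunc.X : RatFunc ℚ) ^
        ((F.niblings : ℤ) + (F.scindex : ℤ) + (F.parents : ℤ) - max ((n : ℤ) - (n : ℤ) - 1) 0) =
      1 := by
  classical
  have huniv : powersetCard (n + 1) (univ : Finset (Fin (n + 1))) = {univ} := by
    rw [← powersetCard_self, card_univ, Fintype.card_fin]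
  rw [sum_leafForests_eq_sum_roots, huniv, sum_singleton, sum_pow_scindex_add_univ]
  simp [inversions]

theorem leafForests_eq_empty {n k : ℕ} (h : n < k) : leafForests n k = ∅ := by
  classical
  refine filter_false_of_mem fun F _ hF => ?_
  have hcard := card_le_univ F.roots
  rw [← numComponents_eq_card_roots, hF.1, Fintype.card_fin] at hcard
  lia

end LeafForests

/-- The exponents are integers, and `max (n - k - 1) 0` is the number of vertices in `V_t(F)`,
so each exponent is `niblings + scindex` plus the sum of `(label of the parent of v) - 1` over
the vertices `v` in `V_t(F)`. -/
theorem corollary3p3 (n k : ℕ) :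
    qTrees n k =
        ∑ F ∈ leafForests n k,
          (RatFunc.X : RatFunc ℚ) ^
            ((F.niblings : ℤ) + (F.scindex : ℤ) + (F.parents : ℤ) - max ((n : ℤ) - (k : ℤ) - 1) 0) ∧
      ∑ F ∈ leafForests n k,
          (RatFunc.X : RatFunc ℚ) ^
            ((F.niblings : ℤ) + (F.scindex : ℤ) + (F.parents : ℤ) - max ((n : ℤ) - (k : ℤ) - 1) 0) =
        qBinomial n k * qInt n ^ (n - k) := by
  rw [qTrees, eq_comm, and_self]
  obtain h | rfl | h := lt_trichotomy k n
  · exact sum_leafForests_of_lt h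
  · rw [sum_leafForests_self, qBinomial_self, Nat.sub_self, pow_zero, one_mul]
  · rw [leafForests_eq_empty h, sum_empty, qBinomial_eq_zero_of_lt h, zero_mul]
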